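/- Let $L$ be a finite-dimensional solvable Lie algebra over a field $F$ (of any characteristic). The Frattini subalgebra $\phi(L)$ is the intersection of all maximal subalgebras of $L$ (and $\phi(L)=L$ if $L=0$); $L$ is called $\phi$-free if $\phi(L)=0$. Let $0=A_0\subset A_1\subset\dots\subset A_n=L$ be a chief series of $L$, i.e. a chain of ideals of $L$ in which no further ideal can be inserted; such a series exists. The factor $A_i/A_{i-1}$ is Frattini if $A_i/A_{i-1}\subseteq\phi(L/A_{i-1})$. Let $\mathcal I$ be the set of those $i\in\{1,\dots,n\}$ for which $A_i/A_{i-1}$ is not Frattini, and for $i\in\mathcal I$ let $\mathcal M_i$ be the set of maximal subalgebras $M$ of $L$ with $A_{i-1}\subseteq M$ and $A_i\not\subseteq M$. A prefrattini subalgebra of $L$ is a subalgebra of the form $\bigcap_{i\in\mathcal I}M_i$ with $M_i\in\mathcal M_i$ for every $i\in\mathcal I$ (the empty intersection being $L$). Then, whichever chief series is used to form the prefrattini subalgebras, the following are equivalent: (i) $L$ is complemented, i.e. for every subalgebra $S$ of $L$ there is a subalgebra $T$ of $L$ such that $S\cap T=0$ and $S$ and $T$ together generate $L$ as a Lie algebra;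 (ii) every prefrattini subalgebra of $L$ is $0$; (iii) $L$ and all its epimorphic images are $\phi$-free; (iv) $L$ splits over each of its ideals, i.e. for every ideal $I$ of $L$ there is a subalgebra $C$ of $L$ such that $L=I+C$ and $I\cap C=0$. -/

import Mathlib

universe u

/-- The Frattini subalgebra `φ(L)`: the intersection of all maximal subalgebras of `L`
(all of `L` if there are none). -/
def LieAlgebra.frattini (F L : Type*) [CommRing F] [LieRing L] [LieAlgebra F L] :
    LieSubalgebra F L :=
  sInf {M : LieSubalgebra F L | IsCoatom M}

/-- `L` is `φ`-free if its Frattini subalgebra is zero. -/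
def LieAlgebra.IsPhiFree (F L : Type*) [CommRing F] [LieRing L] [LieAlgebra F L] : Prop :=
  LieAlgebra.frattini F L = ⊥

/-- `L` splits over the ideal `I` if `L` is the vector space direct sum of `I` and some
subalgebra. -/
def LieAlgebra.SplitsOver {F L : Type*} [CommRing F] [LieRing L] [LieAlgebra F L]
    (I : LieIdeal F L) : Prop :=
  ∃ C : LieSubalgebra F L, IsCompl I.toSubmodule C.toSubmodule

/-- A chief series `0 = A₀ ⊂ A₁ ⊂ ⋯ ⊂ Aₙ = L`: a maximal finite chain of ideals of `L`. -/
structure LieAlgebra.ChiefSeries (F L : Type*) [CommRing F] [LieRing L] [LieAlgebra F L] where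
  length : ℕ
  ideal : Fin (length + 1) → LieIdeal F L
  ideal_zero : ideal 0 = ⊥
  ideal_last : ideal (Fin.last length) = ⊤
  covBy : ∀ i : Fin length, ideal i.castSucc ⋖ ideal i.succ

namespace LieAlgebra.ChiefSeries

variable {F L : Type*} [CommRing F] [LieRing L] [LieAlgebra F L]

/-- The `i`-th factor `A/B` (with `B = ideal i.castSucc` and `A = ideal i.succ`) is a Frattini
chief factor if `A/B ⊆ φ(L/B)`. -/
def IsFrattiniFactor (s : ChiefSeries F L) (i : Fin s.length) : Prop :=
  ∀ x ∈ s.ideal i.succ,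
    (LieSubmodule.Quotient.mk x : L ⧸ s.ideal i.castSucc) ∈
      LieAlgebra.frattini F (L ⧸ s.ideal i.castSucc)

/-- The maximal subalgebras of `L` that contain the lower term of the `i`-th chief factor but
not the upper one. -/
def maximals (s : ChiefSeries F L) (i : Fin s.length) : Set (LieSubalgebra F L) :=
  {M | IsCoatom M ∧ (s.ideal i.castSucc).toLieSubalgebra ≤ M ∧
    ¬ (s.ideal i.succ).toLieSubalgebra ≤ M}

/-- `B` is a prefrattini subalgebra of `L` (formed with the chief series `s`): an intersection of
members of `s.maximals i`, one chosen for each non-Frattini chief factor `i`. -/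
def IsPrefrattini (s : ChiefSeries F L) (B : LieSubalgebra F L) : Prop :=
  ∃ M : Fin s.length → LieSubalgebra F L,
    (∀ i, ¬ s.IsFrattiniFactor i → M i ∈ s.maximals i) ∧
    B = ⨅ (i : Fin s.length) (_ : ¬ s.IsFrattiniFactor i), M i

end LieAlgebra.ChiefSeries

/-!
Everything rests on two properties of a chief factor `B/A` of a solvable Lie algebra. It is abelian,
so a subalgebra `U ⊇ A` with `U + B = L` meets `B` in an ideal between `A` and `B`: either `U ⊇ B`,
or `U` is maximal and complements `B/A`. And `B/A` is Frattini exactly when no maximal subalgebra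
contains `A` but not `B`. Hence the factors that are not Frattini are the complemented ones, and a
prefrattini subalgebra avoids them and covers the Frattini ones. It is therefore zero if and only if
every chief factor is complemented, and complements of the factors are assembled into a complement
of an arbitrary subalgebra by descending along the chief series.
-/

namespace Prefrattini

/-- `x` and `y` are complements of each other in the interval `[a, ⊤]`. For a subalgebra `M` and
ideals `A ≤ B`, `IsComplOver A M B` says that `M` complements the factor `B/A`. -/
structure IsComplOver {α : Type*} [Lattice α] [OrderTop α] (a x y : α) : Prop where
  inf_eq : x ⊓ y = a
  sup_eq_top : x ⊔ y = ⊤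

theorem isComplOver_bot_iff {α : Type*} [Lattice α] [BoundedOrder α] {x y : α} :
    IsComplOver ⊥ x y ↔ IsCompl x y :=
  ⟨fun h ↦ IsCompl.of_eq h.inf_eq h.sup_eq_top, fun h ↦ ⟨h.inf_eq_bot, h.sup_eq_top⟩⟩

variable {R L : Type*} [CommRing R] [LieRing L] [LieAlgebra R L]

section Modularity

variable {A B I : LieIdeal R L} {X Y : LieSubalgebra R L}

theorem toLieSubalgebra_le_toLieSubalgebra :
    A.toLieSubalgebra ≤ B.toLieSubalgebra ↔ A ≤ B :=
  Iff.rfl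

theorem toLieSubalgebra_bot : (⊥ : LieIdeal R L).toLieSubalgebra = ⊥ := by
  simp only [← LieSubalgebra.toSubmodule_eq_bot, LieIdeal.toLieSubalgebra_toSubmodule,
    LieSubmodule.bot_toSubmodule]

theorem sup_toLieSubalgebra_toSubmodule (X : LieSubalgebra R L) (I : LieIdeal R L) :
    (X ⊔ I.toLieSubalgebra).toSubmodule = X.toSubmodule ⊔ I.toSubmodule := by
  obtain ⟨K, hK⟩ : ∃ K : LieSubalgebra R L, K.toSubmodule = X.toSubmodule ⊔ I.toSubmodule := by
    refine (Submodule.exists_lieSubalgebra_coe_eq_iff _).2 fun x y hx hy ↦ ?_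
    obtain ⟨m, hm, a, ha, rfl⟩ := Submodule.mem_sup.1 hx
    obtain ⟨n, hn, b, hb, rfl⟩ := Submodule.mem_sup.1 hy
    rw [add_lie, lie_add, add_assoc]
    exact Submodule.add_mem_sup (X.lie_mem hm hn)
      (I.add_mem (I.lie_mem hb) (lie_mem_left R L I a _ ha))
  refine le_antisymm ?_ (sup_le (LieSubalgebra.toSubmodule_le_toSubmodule _ _ |>.2 le_sup_left)
    (LieSubalgebra.toSubmodule_le_toSubmodule I.toLieSubalgebra _ |>.2 le_sup_right))
  rw [← hK, LieSubalgebra.toSubmodule_le_toSubmodule]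
  refine sup_le ?_ ?_ <;> rw [← LieSubalgebra.toSubmodule_le_toSubmodule, hK]
  exacts [le_sup_left, le_sup_right]

theorem isCompl_toSubmodule_iff :
    IsCompl I.toSubmodule X.toSubmodule ↔ IsCompl X I.toLieSubalgebra := by
  rw [isCompl_comm, isCompl_iff, isCompl_iff, codisjoint_iff, codisjoint_iff,
    ← LieSubalgebra.disjoint_toSubmodule, ← LieSubalgebra.toSubmodule_eq_top,
    sup_toLieSubalgebra_toSubmodule, LieIdeal.toLieSubalgebra_toSubmodule]

theorem inf_sup_assoc_of_ideal_le (Y : LieSubalgebra R L) (h : I.toLieSubalgebra ≤ X) :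
    X ⊓ (Y ⊔ I.toLieSubalgebra) = X ⊓ Y ⊔ I.toLieSubalgebra := by
  have h' : I.toSubmodule ≤ X.toSubmodule := h
  simp only [← LieSubalgebra.toSubmodule_inj, LieSubalgebra.inf_toSubmodule,
    sup_toLieSubalgebra_toSubmodule, inf_sup_assoc_of_le _ h']

theorem eq_of_le_of_inf_ideal_le_of_le_sup_ideal (hXY : X ≤ Y) (hinf : Y ⊓ I.toLieSubalgebra ≤ X)
    (hsup : Y ≤ X ⊔ I.toLieSubalgebra) : X = Y := by
  rw [← LieSubalgebra.toSubmodule_le_toSubmodule] at hXY hinf hsup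
  rw [sup_toLieSubalgebra_toSubmodule] at hsup
  exact LieSubalgebra.toSubmodule_injective (eq_of_le_of_inf_le_of_le_sup hXY hinf hsup)

theorem IsComplOver.of_isCompl (hAB : A ≤ B) (h : IsCompl X B.toLieSubalgebra) :
    IsComplOver A.toLieSubalgebra (X ⊔ A.toLieSubalgebra) B.toLieSubalgebra where
  inf_eq := by
    rw [inf_comm, inf_sup_assoc_of_ideal_le X (toLieSubalgebra_le_toLieSubalgebra.2 hAB),
      inf_comm, h.inf_eq_bot, bot_sup_eq]
  sup_eq_top := by
    rw [sup_assoc, sup_eq_right.2 (toLieSubalgebra_le_toLieSubalgebra.2 hAB), h.sup_eq_top]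

end Modularity

section Frattini

variable {L' : Type*} [LieRing L'] [LieAlgebra R L'] {f : L →ₗ⁅R⁆ L'}

theorem comap_map_of_ker_le {K : LieSubalgebra R L} (h : f.ker.toLieSubalgebra ≤ K) :
    (K.map f).comap f = K := by
  refine le_antisymm (fun x hx ↦ ?_) (LieSubalgebra.gc_map_comap.le_u_l K)
  obtain ⟨z, hz, hzx⟩ := (LieSubalgebra.mem_map _ _ _).1 hx
  have hker : x - z ∈ f.ker := by
    rw [LieHom.mem_ker, map_sub]
    exact sub_eq_zero.2 hzx.symm
  simpa only [sub_add_cancel] using add_mem (h hker) hz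

theorem ker_le_comap (M : LieSubalgebra R L') : f.ker.toLieSubalgebra ≤ M.comap f := by
  intro x hx
  rw [LieSubalgebra.mem_comap, LieHom.mem_ker.1 hx]
  exact M.zero_mem

theorem map_comap_of_surjective (hf : Function.Surjective f) (M : LieSubalgebra R L') :
    (M.comap f).map f = M :=
  SetLike.coe_injective (Set.image_preimage_eq _ hf)

theorem isCoatom_comap_iff (hf : Function.Surjective f) {M : LieSubalgebra R L'} :
    IsCoatom (M.comap f) ↔ IsCoatom M := by
  let gi : GaloisInsertion (LieSubalgebra.map f) (LieSubalgebra.comap f) :=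
    LieSubalgebra.gc_map_comap.toGaloisInsertion fun M ↦ (map_comap_of_surjective hf M).ge
  refine ⟨gi.isCoatom_of_image, fun hM ↦ ⟨fun h ↦ hM.1 ?_, fun K hK ↦ ?_⟩⟩
  · rw [← gi.l_u_eq M, h, gi.l_top]
  · have hKf : (K.map f).comap f = K := comap_map_of_ker_le ((ker_le_comap M).trans hK.le)
    rw [← hKf] at hK ⊢
    have hMK : M < K.map f :=
      (gi.u_le_u_iff.1 hK.le).lt_of_not_ge fun h ↦ hK.not_ge (gi.u_le_u_iff.2 h)
    rw [hM.2 _ hMK, gi.gc.u_top]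

theorem comap_frattini (hf : Function.Surjective f) :
    (LieAlgebra.frattini R L').comap f =
      sInf {M : LieSubalgebra R L | IsCoatom M ∧ f.ker.toLieSubalgebra ≤ M} := by
  refine le_antisymm (le_sInf fun M ⟨hM, hker⟩ ↦ ?_) ?_
  · rw [← comap_map_of_ker_le hker] at hM ⊢
    exact LieSubalgebra.gc_map_comap.monotone_u (sInf_le ((isCoatom_comap_iff hf).1 hM))
  · rw [← LieSubalgebra.map_le_iff_le_comap]
    refine le_sInf fun M hM ↦ LieSubalgebra.map_le_iff_le_comap.2 ?_
    exact sInf_le ⟨(isCoatom_comap_iff hf).2 hM, ker_le_comap M⟩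

theorem isPhiFree_of_surjective [IsCoatomic (LieSubalgebra R L)]
    [ComplementedLattice (LieSubalgebra R L)] (hf : Function.Surjective f) :
    LieAlgebra.IsPhiFree R L' := by
  set P := (LieAlgebra.frattini R L').comap f with hP
  obtain ⟨T, hT⟩ := exists_isCompl P
  have hTker : T ⊔ f.ker.toLieSubalgebra = ⊤ := by
    refine (eq_top_or_exists_le_coatom _).resolve_right fun ⟨M, hM, hle⟩ ↦ hM.1 ?_
    rw [sup_le_iff] at hle
    have hPM : P ≤ M := hP ▸ comap_frattini hf ▸ sInf_le ⟨hM, hle.2⟩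
    exact top_le_iff.1 (hT.sup_eq_top ▸ sup_le hPM hle.1)
  have hPker : P = f.ker.toLieSubalgebra := by
    rw [← inf_top_eq P, ← hTker, inf_sup_assoc_of_ideal_le T (ker_le_comap _), hT.inf_eq_bot,
      bot_sup_eq]
  refine (LieSubalgebra.eq_bot_iff _).2 fun y hy ↦ ?_
  obtain ⟨x, rfl⟩ := hf y
  exact LieHom.mem_ker.1 (hPker.le hy)

/-- The quotient map by an ideal, which Mathlib only has as a morphism of Lie modules. -/
def quotientMk (I : LieIdeal R L) : L →ₗ⁅R⁆ L ⧸ I :=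
  { (LieSubmodule.Quotient.mk' I : L →ₗ[R] L ⧸ I) with
    map_lie' := fun {x y} ↦ LieSubmodule.Quotient.mk_bracket I x y }

theorem quotientMk_surjective (I : LieIdeal R L) : Function.Surjective (quotientMk I) :=
  LieSubmodule.Quotient.surjective_mk' I

theorem ker_quotientMk (I : LieIdeal R L) : (quotientMk I).ker = I := by
  ext x
  exact LieSubmodule.Quotient.mk_eq_zero'

end Frattini

section ChiefFactor

variable {A B : LieIdeal R L} {M S U : LieSubalgebra R L}

theorem le_of_le_sup_lie_self [LieAlgebra.IsSolvable L] (h : B ≤ A ⊔ ⁅B, B⁆) : B ≤ A := by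
  open LieAlgebra in
  have hD (k : ℕ) : B ≤ A ⊔ derivedSeriesOfIdeal R L k ⊤ := by
    induction k with
    | zero => exact le_sup_of_le_right le_top
    | succ k ih =>
      refine h.trans (sup_le le_sup_left ((LieSubmodule.mono_lie ih ih).trans ?_))
      simpa only [zero_add, derivedSeriesOfIdeal_zero, derivedSeriesOfIdeal_succ,
        LieSubmodule.add_eq_sup] using
        derivedSeriesOfIdeal_add_le_add A (derivedSeriesOfIdeal R L k ⊤) 0 1
  obtain ⟨k, hk⟩ := LieAlgebra.IsSolvable.solvable R L
  simpa only [← LieAlgebra.derivedSeries_def, hk, sup_bot_eq] using hD k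

theorem lie_self_le_of_covBy [LieAlgebra.IsSolvable L] (h : A ⋖ B) : ⁅B, B⁆ ≤ A := by
  rcases h.eq_or_eq le_sup_left (sup_le h.le (LieSubmodule.lie_le_left B B)) with hA | hB
  · exact sup_eq_left.1 hA
  · exact absurd (le_of_le_sup_lie_self hB.ge) h.lt.not_ge

theorem exists_ideal_eq_inf (hlie : ⁅B, B⁆.toLieSubalgebra ≤ U)
    (hsup : U ⊔ B.toLieSubalgebra = ⊤) :
    ∃ J : LieIdeal R L, J.toLieSubalgebra = U ⊓ B.toLieSubalgebra := by
  refine (LieSubalgebra.exists_lieIdeal_coe_eq_iff _ _).2 fun x y ⟨hyU, hyB⟩ ↦ ⟨?_, B.lie_mem hyB⟩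
  have hx : x ∈ U.toSubmodule ⊔ B.toSubmodule := by
    rw [← sup_toLieSubalgebra_toSubmodule, hsup]
    exact LieSubalgebra.mem_top x
  obtain ⟨u, hu, b, hb, rfl⟩ := Submodule.mem_sup.1 hx
  rw [add_lie]
  exact U.add_mem (U.lie_mem hu hyU) (hlie (LieSubmodule.lie_mem_lie hb hyB))

variable [LieAlgebra.IsSolvable L]

theorem isComplOver_of_covBy (h : A ⋖ B) (hA : A.toLieSubalgebra ≤ U)
    (hB : ¬ B.toLieSubalgebra ≤ U) (hsup : U ⊔ B.toLieSubalgebra = ⊤) :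
    IsComplOver A.toLieSubalgebra U B.toLieSubalgebra := by
  refine ⟨?_, hsup⟩
  obtain ⟨J, hJ⟩ := exists_ideal_eq_inf
    ((toLieSubalgebra_le_toLieSubalgebra.2 (lie_self_le_of_covBy h)).trans hA) hsup
  have hAJ : A ≤ J := by
    rw [← toLieSubalgebra_le_toLieSubalgebra, hJ]
    exact le_inf hA (toLieSubalgebra_le_toLieSubalgebra.2 h.le)
  have hJB : J ≤ B := by
    rw [← toLieSubalgebra_le_toLieSubalgebra, hJ]
    exact inf_le_right
  rcases h.eq_or_eq hAJ hJB with rfl | rfl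
  · exact hJ.symm
  · exact absurd (inf_eq_right.1 hJ.symm) hB

theorem isCoatom_of_covBy (h : A ⋖ B) (hA : A.toLieSubalgebra ≤ U)
    (hB : ¬ B.toLieSubalgebra ≤ U) (hsup : U ⊔ B.toLieSubalgebra = ⊤) : IsCoatom U := by
  refine ⟨fun hU ↦ hB (hU ▸ le_top), fun K hUK ↦ ?_⟩
  have hKsup : K ⊔ B.toLieSubalgebra = ⊤ := top_le_iff.1 (hsup ▸ sup_le_sup_right hUK.le _)
  suffices hBK : B.toLieSubalgebra ≤ K by rwa [sup_eq_left.2 hBK] at hKsup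
  by_contra hBK
  have hK := isComplOver_of_covBy h (hA.trans hUK.le) hBK hKsup
  exact hUK.ne (eq_of_le_of_inf_ideal_le_of_le_sup_ideal hUK.le (hK.inf_eq.trans_le hA)
    (hsup ▸ le_top))

theorem exists_isComplOver_of_covBy (h : A ⋖ B)
    (hM : IsComplOver A.toLieSubalgebra M B.toLieSubalgebra)
    (hB : ∀ S : LieSubalgebra R L, B.toLieSubalgebra ≤ S → ∃ T, IsComplOver B.toLieSubalgebra S T)
    (hS : A.toLieSubalgebra ≤ S) : ∃ T, IsComplOver A.toLieSubalgebra S T := by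
  have hAB := toLieSubalgebra_le_toLieSubalgebra.2 h.le
  obtain ⟨T, hT⟩ := hB (S ⊔ B.toLieSubalgebra) le_sup_right
  have hBT : B.toLieSubalgebra ≤ T := hT.inf_eq ▸ inf_le_right
  have hST : S ⊓ T ≤ B.toLieSubalgebra := hT.inf_eq ▸ inf_le_inf_right T le_sup_left
  by_cases hSB : S ⊓ B.toLieSubalgebra = A.toLieSubalgebra
  · refine ⟨T, le_antisymm (hSB ▸ le_inf inf_le_left hST) (le_inf hS (hAB.trans hBT)), ?_⟩
    rw [← hT.sup_eq_top, sup_assoc, sup_eq_right.2 hBT]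
  · have hAM : A.toLieSubalgebra ≤ M := hM.inf_eq ▸ inf_le_left
    refine ⟨T ⊓ M, le_antisymm ?_ (le_inf hS (le_inf (hAB.trans hBT) hAM)), ?_⟩
    · rw [← inf_assoc, ← hM.inf_eq, inf_comm M]
      exact inf_le_inf_right M hST
    have hTM : T ⊓ M ⊔ B.toLieSubalgebra = T := by
      rw [← inf_sup_assoc_of_ideal_le M hBT, hM.sup_eq_top, inf_top_eq]
    have hsup : S ⊔ T ⊓ M ⊔ B.toLieSubalgebra = ⊤ := by
      rw [sup_assoc, hTM, ← hT.sup_eq_top, sup_assoc, sup_eq_right.2 hBT]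
    suffices hle : B.toLieSubalgebra ≤ S ⊔ T ⊓ M by rwa [sup_eq_left.2 hle] at hsup
    by_contra hle
    have hcompl := isComplOver_of_covBy h (hS.trans le_sup_left) hle hsup
    exact hSB (le_antisymm (hcompl.inf_eq ▸ inf_le_inf_right _ le_sup_left) (le_inf hS hAB))

end ChiefFactor

section Chain

variable {n : ℕ} {A : Fin (n + 1) → LieIdeal R L} {N : Fin n → LieSubalgebra R L}

theorem iInf_lt_sup_eq_top (hA : Monotone A) (hle : ∀ i, (A i.castSucc).toLieSubalgebra ≤ N i)
    (hsup : ∀ i, N i ⊔ (A i.succ).toLieSubalgebra = ⊤) (j : Fin (n + 1)) :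
    (⨅ (i : Fin n) (_ : i.castSucc < j), N i) ⊔ (A j).toLieSubalgebra = ⊤ := by
  induction j using Fin.induction with
  | zero => simp only [Fin.not_lt_zero, iInf_false, iInf_top, top_sup_eq]
  | succ k ih =>
    set C := ⨅ (i : Fin n) (_ : i.castSucc < k.castSucc), N i
    have hC : N k ⊓ C ≤ ⨅ (i : Fin n) (_ : i.castSucc < k.succ), N i := by
      refine le_iInf₂ fun i hi ↦ ?_
      rcases (Fin.castSucc_lt_succ_iff.1 hi).eq_or_lt with rfl | hlt
      · exact inf_le_left
      · exact inf_le_right.trans (iInf₂_le i (Fin.castSucc_lt_castSucc_iff.2 hlt))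
    rw [eq_top_iff, ← hsup k]
    refine sup_le ?_ le_sup_right
    calc N k = N k ⊓ C ⊔ (A k.castSucc).toLieSubalgebra := by
            rw [← inf_sup_assoc_of_ideal_le C (hle k), ih, inf_top_eq]
      _ ≤ _ := sup_le_sup hC (toLieSubalgebra_le_toLieSubalgebra.2 (hA k.castSucc_le_succ))

theorem le_iInf_sup_of_eq_top (hA : Monotone A) (hle : ∀ i, (A i.castSucc).toLieSubalgebra ≤ N i)
    (hsup : ∀ i, N i ⊔ (A i.succ).toLieSubalgebra = ⊤) {k : Fin n} (hk : N k = ⊤) :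
    (A k.succ).toLieSubalgebra ≤ (⨅ i, N i) ⊔ (A k.castSucc).toLieSubalgebra := by
  have htop := iInf_lt_sup_eq_top hA hle hsup k.castSucc
  set C := ⨅ (i : Fin n) (_ : i.castSucc < k.castSucc), N i
  have hC : (A k.succ).toLieSubalgebra ⊓ C ≤ ⨅ i, N i := by
    refine le_iInf fun i ↦ ?_
    rcases lt_trichotomy i k with hlt | rfl | hlt
    · exact inf_le_right.trans (iInf₂_le i (Fin.castSucc_lt_castSucc_iff.2 hlt))
    · exact hk ▸ le_top
    · exact inf_le_left.trans ((toLieSubalgebra_le_toLieSubalgebra.2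
        (hA (Fin.succ_le_castSucc_iff.2 hlt))).trans (hle i))
  calc (A k.succ).toLieSubalgebra
      = (A k.succ).toLieSubalgebra ⊓ C ⊔ (A k.castSucc).toLieSubalgebra := by
        rw [← inf_sup_assoc_of_ideal_le C
          (toLieSubalgebra_le_toLieSubalgebra.2 (hA k.castSucc_le_succ)), htop, inf_top_eq]
    _ ≤ _ := sup_le_sup_right hC _

end Chain

end Prefrattini

namespace LieAlgebra.ChiefSeries

open Prefrattini

variable {R L : Type*} [CommRing R] [LieRing L] [LieAlgebra R L]

theorem nonempty [WellFoundedLT (LieIdeal R L)] [WellFoundedGT (LieIdeal R L)] :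
    Nonempty (ChiefSeries R L) := by
  obtain ⟨a, h0, n, hn, h⟩ :=
    exists_covBy_seq_of_wellFoundedLT_wellFoundedGT_of_le (bot_le : (⊥ : LieIdeal R L) ≤ ⊤)
  exact ⟨⟨n, fun i ↦ a i, h0, hn, fun i ↦ h i i.2⟩⟩

variable {s : ChiefSeries R L} {B : LieSubalgebra R L} {i : Fin s.length}

theorem ideal_monotone (s : ChiefSeries R L) : Monotone s.ideal :=
  Fin.monotone_iff_le_succ.2 fun i ↦ (s.covBy i).le

theorem toLieSubalgebra_ideal_zero (s : ChiefSeries R L) : (s.ideal 0).toLieSubalgebra = ⊥ := by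
  rw [s.ideal_zero, toLieSubalgebra_bot]

theorem toLieSubalgebra_ideal_last (s : ChiefSeries R L) :
    (s.ideal (Fin.last _)).toLieSubalgebra = ⊤ := by
  rw [s.ideal_last, LieIdeal.top_toLieSubalgebra]

theorem isFrattiniFactor_iff_maximals_eq_empty : s.IsFrattiniFactor i ↔ s.maximals i = ∅ := by
  have hcomap : s.IsFrattiniFactor i ↔ (s.ideal i.succ).toLieSubalgebra ≤
      (frattini R (L ⧸ s.ideal i.castSucc)).comap (quotientMk (s.ideal i.castSucc)) := Iff.rfl
  rw [hcomap, comap_frattini (quotientMk_surjective _), ker_quotientMk, le_sInf_iff,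
    Set.eq_empty_iff_forall_notMem]
  simp only [maximals, Set.mem_ofPred_eq, not_and, not_not, and_imp]

theorem not_isFrattiniFactor_of_isPhiFree (h : IsPhiFree R (L ⧸ s.ideal i.castSucc)) :
    ¬ s.IsFrattiniFactor i := by
  intro hi
  refine (s.covBy i).lt.not_ge fun x hx ↦ LieSubmodule.Quotient.mk_eq_zero'.1 ?_
  exact (LieSubalgebra.mem_bot _).1 (h ▸ hi x hx)

theorem sup_eq_top_of_mem_maximals {M : LieSubalgebra R L} (hM : M ∈ s.maximals i) :
    M ⊔ (s.ideal i.succ).toLieSubalgebra = ⊤ :=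
  hM.1.2 _ (left_lt_sup.2 hM.2.2)

theorem exists_isPrefrattini (s : ChiefSeries R L) : ∃ B, s.IsPrefrattini B := by
  choose! M hM using fun i (hi : ¬ s.IsFrattiniFactor i) ↦
    Set.nonempty_iff_ne_empty.2 (isFrattiniFactor_iff_maximals_eq_empty.not.1 hi)
  exact ⟨_, M, hM, rfl⟩

theorem IsPrefrattini.covers (hB : s.IsPrefrattini B) (hi : s.IsFrattiniFactor i) :
    (s.ideal i.succ).toLieSubalgebra ≤ B ⊔ (s.ideal i.castSucc).toLieSubalgebra := by
  obtain ⟨M, hM, rfl⟩ := hB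
  refine le_iInf_sup_of_eq_top s.ideal_monotone (fun j ↦ le_iInf fun hj ↦ (hM j hj).2.1)
    (fun j ↦ ?_) (by simp only [hi, not_true_eq_false, iInf_false])
  by_cases hj : s.IsFrattiniFactor j
  · simp only [hj, not_true_eq_false, iInf_false, top_sup_eq]
  · simpa only [hj, not_false_eq_true, iInf_true] using sup_eq_top_of_mem_maximals (hM j hj)

theorem not_isFrattiniFactor_of_isPrefrattini_bot (h : s.IsPrefrattini ⊥) :
    ¬ s.IsFrattiniFactor i := by
  intro hi
  have hle := h.covers hi
  rw [bot_sup_eq, toLieSubalgebra_le_toLieSubalgebra] at hle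
  exact (s.covBy i).lt.not_ge hle

variable [IsSolvable L]

theorem isComplOver_of_mem_maximals {M : LieSubalgebra R L} (hM : M ∈ s.maximals i) :
    IsComplOver (s.ideal i.castSucc).toLieSubalgebra M (s.ideal i.succ).toLieSubalgebra :=
  isComplOver_of_covBy (s.covBy i) hM.2.1 hM.2.2 (sup_eq_top_of_mem_maximals hM)

theorem IsPrefrattini.avoids (hB : s.IsPrefrattini B) (hi : ¬ s.IsFrattiniFactor i) :
    B ⊓ (s.ideal i.succ).toLieSubalgebra ≤ (s.ideal i.castSucc).toLieSubalgebra := by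
  obtain ⟨M, hM, rfl⟩ := hB
  rw [← (isComplOver_of_mem_maximals (hM i hi)).inf_eq]
  exact inf_le_inf_right _ (iInf₂_le i hi)

theorem IsPrefrattini.eq_bot (hB : s.IsPrefrattini B) (h : ∀ i, ¬ s.IsFrattiniFactor i) :
    B = ⊥ := by
  have hBA (j : Fin (s.length + 1)) : B ⊓ (s.ideal j).toLieSubalgebra = ⊥ := by
    induction j using Fin.induction with
    | zero => rw [s.toLieSubalgebra_ideal_zero, inf_bot_eq]
    | succ i ih => exact eq_bot_iff.2 (ih ▸ le_inf inf_le_left (hB.avoids (h i)))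
  simpa only [s.toLieSubalgebra_ideal_last, inf_top_eq] using hBA (Fin.last _)

theorem isCoatomic (s : ChiefSeries R L) : IsCoatomic (LieSubalgebra R L) := by
  refine ⟨fun T ↦ ?_⟩
  have hT (j : Fin (s.length + 1)) :
      T ⊔ (s.ideal j).toLieSubalgebra = ⊤ ∨ ∃ M, IsCoatom M ∧ T ≤ M := by
    induction j using Fin.reverseInduction with
    | last => exact .inl (by rw [s.toLieSubalgebra_ideal_last, sup_top_eq])
    | cast i ih =>
      refine ih.elim (fun hsup ↦ ?_) .inr
      have hsup' : T ⊔ (s.ideal i.castSucc).toLieSubalgebra ⊔ (s.ideal i.succ).toLieSubalgebra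
          = ⊤ := top_le_iff.1 (hsup ▸ sup_le_sup_right le_sup_left _)
      by_cases hle : (s.ideal i.succ).toLieSubalgebra ≤ T ⊔ (s.ideal i.castSucc).toLieSubalgebra
      · exact .inl (by rwa [sup_eq_left.2 hle] at hsup')
      · exact .inr ⟨_, isCoatom_of_covBy (s.covBy i) le_sup_right hle hsup', le_sup_left⟩
  simpa only [s.toLieSubalgebra_ideal_zero, sup_bot_eq] using hT 0

theorem complementedLattice (s : ChiefSeries R L)
    (h : ∀ i : Fin s.length, ∃ M, IsComplOver (s.ideal i.castSucc).toLieSubalgebra M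
      (s.ideal i.succ).toLieSubalgebra) :
    ComplementedLattice (LieSubalgebra R L) := by
  have hcompl (j : Fin (s.length + 1)) : ∀ S, (s.ideal j).toLieSubalgebra ≤ S →
      ∃ T, IsComplOver (s.ideal j).toLieSubalgebra S T := by
    induction j using Fin.reverseInduction with
    | last =>
      intro S hS
      rw [s.toLieSubalgebra_ideal_last] at hS ⊢
      exact ⟨⊤, by rw [inf_top_eq, top_le_iff.1 hS], sup_top_eq S⟩
    | cast i ih =>
      obtain ⟨M, hM⟩ := h i
      exact fun S ↦ exists_isComplOver_of_covBy (s.covBy i) hM ih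
  refine ⟨fun S ↦ ?_⟩
  simpa only [s.toLieSubalgebra_ideal_zero, bot_le, forall_const, isComplOver_bot_iff]
    using hcompl 0 S

end LieAlgebra.ChiefSeries

open Prefrattini in
theorem theorem2p1_general {R : Type*} {L : Type u} [CommRing R] [LieRing L] [LieAlgebra R L]
    [LieAlgebra.IsSolvable L] (s : LieAlgebra.ChiefSeries R L) :
    List.TFAE [
      ComplementedLattice (LieSubalgebra R L),
      ∀ B : LieSubalgebra R L, s.IsPrefrattini B → B = ⊥,
      LieAlgebra.IsPhiFree R L ∧
        ∀ (L' : Type u) [LieRing L'] [LieAlgebra R L'] (f : L →ₗ⁅R⁆ L'),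
          Function.Surjective f → LieAlgebra.IsPhiFree R L',
      ∀ I : LieIdeal R L, LieAlgebra.SplitsOver I] := by
  tfae_have 1 → 3 := fun _ ↦ by
    have := s.isCoatomic
    exact ⟨isPhiFree_of_surjective (f := LieHom.id) Function.surjective_id,
      fun _ _ _ _ hf ↦ isPhiFree_of_surjective hf⟩
  tfae_have 3 → 2 := fun h B hB ↦ hB.eq_bot fun _ ↦
    LieAlgebra.ChiefSeries.not_isFrattiniFactor_of_isPhiFree (h.2 _ _ (quotientMk_surjective _))
  tfae_have 2 → 1 := fun h ↦ s.complementedLattice fun i ↦ by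
    obtain ⟨B, hB⟩ := s.exists_isPrefrattini
    have hi := LieAlgebra.ChiefSeries.not_isFrattiniFactor_of_isPrefrattini_bot (i := i)
      (h B hB ▸ hB)
    rw [LieAlgebra.ChiefSeries.isFrattiniFactor_iff_maximals_eq_empty] at hi
    obtain ⟨M, hM⟩ := Set.nonempty_iff_ne_empty.2 hi
    exact ⟨M, LieAlgebra.ChiefSeries.isComplOver_of_mem_maximals hM⟩
  tfae_have 1 → 4 := fun _ I ↦ by
    obtain ⟨C, hC⟩ := exists_isCompl I.toLieSubalgebra
    exact ⟨C, isCompl_toSubmodule_iff.2 hC.symm⟩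
  tfae_have 4 → 1 := fun h ↦ s.complementedLattice fun i ↦ by
    obtain ⟨C, hC⟩ := h (s.ideal i.succ)
    exact ⟨_, .of_isCompl (s.covBy i).le (isCompl_toSubmodule_iff.1 hC)⟩
  tfae_finish

theorem theorem2p1 {F : Type*} {L : Type u} [Field F] [LieRing L] [LieAlgebra F L]
    [FiniteDimensional F L] [LieAlgebra.IsSolvable L] :
    Nonempty (LieAlgebra.ChiefSeries F L) ∧
    ∀ s : LieAlgebra.ChiefSeries F L,
      List.TFAE [
        ComplementedLattice (LieSubalgebra F L),
        ∀ B : LieSubalgebra F L, s.IsPrefrattini B → B = ⊥,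
        LieAlgebra.IsPhiFree F L ∧
          ∀ (L' : Type u) [LieRing L'] [LieAlgebra F L'] (f : L →ₗ⁅F⁆ L'),
            Function.Surjective f → LieAlgebra.IsPhiFree F L',
        ∀ I : LieIdeal F L, LieAlgebra.SplitsOver I] := by
  have : WellFoundedLT (LieIdeal F L) := LieSubmodule.wellFoundedLT_of_isArtinian F L L
  exact ⟨LieAlgebra.ChiefSeries.nonempty, theorem2p1_general⟩
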